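/- **Setting.** A graphon is a symmetric measurable function $W:[0,1]^2\to[0,1]$; its shift operator on $L_2([0,1])$ (real-valued functions, norm $\|\cdot\|$) is $(T_WX)(v)=\int_0^1 W(u,v)X(u)\,du$. List the eigenvalues of the compact self-adjoint operator $T_W$ with multiplicity as $\lambda_i(T_W)$, $i\in\mathbb Z\setminus\{0\}$, with $\lambda_1\ge\lambda_2\ge\dots\ge0\ge\dots\ge\lambda_{-2}\ge\lambda_{-1}$, where the list of positive (negative) eigenvalues is continued by zeros if it is finite. For coefficients $\mathbf h=(h_0,\dots,h_{K-1})\in\mathbb R^K$ the graphon filter is $\Phi(X;\mathbf h,W)=\sum_{k=0}^{K-1}h_kT_W^kX$, with spectral response $h(\lambda)=\sum_{k=0}^{K-1}h_k\lambda^k$. For $c>0$ and graphons $W,W'$ put $$B^c_{W}=\#\{i:|\lambda_i(T_W)|\ge c\},\qquad \delta^c_{WW'}=\inf\{|\lambda_i(T_{W'})-\lambda_j(T_W)|:\ i,j\in\mathbb Z\setminus\{0\},\ j\ne i,\ |\lambda_i(T_{W'})|\ge c\}.$$ Let $n\ge1$, $u_i=(i-1)/n$ for $1\le i\le n$, $I_i=[\frac{i-1}n,\frac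 in)$ for $i<n$ and $I_n=[\frac{n-1}n,1]$. The $n$-node template graph of $W$ has the weight matrix $[S_n]_{ij}=W(u_i,u_j)$; it induces the graphon $W_n(u,v)=\sum_{i,j=1}^n[S_n]_{ij}\mathbf 1(u\in I_i)\mathbf 1(v\in I_j)$. A function $X$ on $[0,1]$ gives the graph signal $[x_n]_i=X(u_i)$, which induces the step function $X_n(u)=\sum_{i=1}^n[x_n]_i\mathbf 1(u\in I_i)$. **Proposition.** Let $W$ be a graphon, $X\in L_2([0,1])$ a function, $h(\lambda)=\sum_{k=0}^{K-1}h_k\lambda^k$ a real polynomial, $0<c\le1$, and suppose that 1. $|W(u_2,v_2)-W(u_1,v_1)|\le A_w(|u_2-u_1|+|v_2-v_1|)$ for all $u_1,u_2,v_1,v_2\in[0,1]$; 2. $h$ is $A_h$-Lipschitz on $[-1,-c]\cup[c,1]$ and $a_h$-Lipschitz on $(-c,c)$, with $a_h<A_h$, and $|h(\lambda)|<1$ for $\lambda\in[-1,1]$; 3. $X$ is $A_x$-Lipschitz on $[0,1]$. Let $Y=\Phi(X;\mathbf h,W)$ and let $Y_n=\Phi(X_n;\mathbf h,W_n)$ be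 the output of the graphon filter induced by the graph filter $y_n=\sum_{k=0}^{K-1}h_kS_n^kx_n$ on the template graph. Then for every $n\ge1$ $$\|Y_n-Y\|\le\Big(A_h+\frac{\pi B^c_{W_n}}{\delta^c_{WW_n}}\Big)\frac{2A_w}{n}\|X\|+\frac{A_x(a_hc+2)}{n}+2a_hc\|X\|,$$ where the fraction is read as $0$ when $W_n$ has no eigenvalue of absolute value at least $c$, and also when $\delta^c_{WW_n}=0$. -/

import Mathlib

open MeasureTheory
open scoped unitInterval

noncomputable section

/-- The Hilbert space `L₂([0,1])` of real-valued functions. -/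
abbrev L2I : Type := Lp ℝ 2 (volume : Measure I)

/-- A graphon: a symmetric measurable function `W : [0,1]² → [0,1]`. -/
structure Graphon where
  /-- the kernel `(u, v) ↦ W(u, v)` -/
  toFun : I → I → ℝ
  measurable_toFun : Measurable (Function.uncurry toFun)
  symm : ∀ u v, toFun u v = toFun v u
  nonneg : ∀ u v, 0 ≤ toFun u v
  le_one : ∀ u v, toFun u v ≤ 1

/-- A graphon signal: a function `X : [0,1] → ℝ` in `L₂([0,1])`.  It is an honest function, not an
almost-everywhere class, because it gets evaluated at points. -/
structure GraphonSignal where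
  /-- the function -/
  toFun : I → ℝ
  memLp : MemLp toFun 2 (volume : Measure I)

/-- The class in `L₂([0,1])` of a graphon signal. -/
def GraphonSignal.toL2 (X : GraphonSignal) : L2I := X.memLp.toLp

namespace Graphon

lemma abs_le_one (W : Graphon) (u v : I) : |W.toFun u v| ≤ 1 :=
  abs_le.2 ⟨by linarith [W.nonneg u v], W.le_one u v⟩

/-- `v ↦ ∫₀¹ W(u,v) f(u) du`. -/
def shiftFun (W : Graphon) (f : I → ℝ) (v : I) : ℝ := ∫ u, W.toFun u v * f u

lemma integrable_coe (f : L2I) : Integrable (f : I → ℝ) volume :=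
  (Lp.memLp f).integrable (by norm_num)

lemma integrable_mul (W : Graphon) (f : L2I) (v : I) :
    Integrable (fun u => W.toFun u v * f u) volume := by
  refine (integrable_coe f).bdd_mul (c := 1) ?_ ?_
  · exact (W.measurable_toFun.comp (measurable_id.prodMk measurable_const)).aestronglyMeasurable
  · exact Filter.Eventually.of_forall fun u => W.abs_le_one u v

lemma stronglyMeasurable_shiftFun (W : Graphon) (f : L2I) :
    StronglyMeasurable (W.shiftFun f) := by
  have h : StronglyMeasurable (Function.uncurry fun v u : I => W.toFun u v * f u) := by
    have h1 : Measurable fun p : I × I => W.toFun p.2 p.1 :=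
      W.measurable_toFun.comp (measurable_snd.prodMk measurable_fst)
    have h2 : Measurable fun p : I × I => (f : I → ℝ) p.2 :=
      (Lp.stronglyMeasurable f).measurable.comp measurable_snd
    exact (h1.mul h2).stronglyMeasurable
  exact h.integral_prod_right

lemma integral_abs_le (f : L2I) : ∫ u, |(f : I → ℝ) u| ≤ ‖f‖ := by
  have h1 : ∫ u, |(f : I → ℝ) u| = (eLpNorm f 1 (volume : Measure I)).toReal := by
    rw [eLpNorm_one_eq_lintegral_enorm, ← integral_norm_eq_lintegral_enorm]
    · rfl
    · exact (Lp.aestronglyMeasurable f)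
  rw [h1, Lp.norm_def]
  exact ENNReal.toReal_mono (Lp.eLpNorm_ne_top f)
    (eLpNorm_le_eLpNorm_of_exponent_le (by norm_num) (Lp.aestronglyMeasurable f))

lemma abs_shiftFun_le (W : Graphon) (f : L2I) (v : I) : ‖W.shiftFun f v‖ ≤ ‖f‖ := by
  refine le_trans (norm_integral_le_integral_norm _) (le_trans ?_ (integral_abs_le f))
  refine integral_mono (W.integrable_mul f v).norm (integrable_coe f).abs fun u => ?_
  have := mul_le_mul_of_nonneg_right (W.abs_le_one u v) (abs_nonneg ((f : I → ℝ) u))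
  simpa [Real.norm_eq_abs, abs_mul] using this

lemma memLp_shiftFun (W : Graphon) (f : L2I) :
    MemLp (W.shiftFun f) 2 (volume : Measure I) :=
  MemLp.of_bound (W.stronglyMeasurable_shiftFun f).aestronglyMeasurable ‖f‖
    (Filter.Eventually.of_forall (W.abs_shiftFun_le f))

/-- The graphon shift operator `T_W` on `L₂([0,1])`, `(T_W X)(v) = ∫₀¹ W(u,v) X(u) du`. -/
def shift (W : Graphon) : L2I →L[ℝ] L2I :=
  LinearMap.mkContinuous
    { toFun := fun f => (W.memLp_shiftFun f).toLp
      map_add' := fun f g => by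
        rw [← MemLp.toLp_add]
        refine MemLp.toLp_congr _ _ (Filter.Eventually.of_forall fun v => ?_)
        simp only [shiftFun, Pi.add_apply]
        rw [← integral_add (W.integrable_mul f v) (W.integrable_mul g v)]
        refine integral_congr_ae ?_
        filter_upwards [Lp.coeFn_add f g] with u hu
        rw [hu, Pi.add_apply, mul_add]
      map_smul' := fun a f => by
        rw [RingHom.id_apply, ← MemLp.toLp_const_smul]
        refine MemLp.toLp_congr _ _ (Filter.Eventually.of_forall fun v => ?_)
        simp only [shiftFun, Pi.smul_apply, smul_eq_mul]
        rw [← integral_const_mul]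
        refine integral_congr_ae ?_
        filter_upwards [Lp.coeFn_smul a f] with u hu
        rw [hu, Pi.smul_apply, smul_eq_mul]
        ring }
    1 fun f => by
      have h := Lp.norm_le_of_ae_bound (f := (W.memLp_shiftFun f).toLp) (norm_nonneg f) (by
        filter_upwards [(W.memLp_shiftFun f).coeFn_toLp] with v hv
        rw [hv]
        exact W.abs_shiftFun_le f v)
      simpa [measureUnivNNReal] using h

/-- The graphon filter `Φ(·; h, W) = ∑ₖ hₖ T_W^k` with coefficients `h₀, …, h_{K-1}`. -/
def filter (W : Graphon) {K : ℕ} (h : Fin K → ℝ) : L2I →L[ℝ] L2I :=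
  ∑ k : Fin K, h k • W.shift ^ (k : ℕ)

end Graphon

/-- The spectral response `h(λ) = ∑ₖ hₖ λ^k` of the filter with coefficients `h₀, …, h_{K-1}`. -/
def spectralResponse {K : ℕ} (h : Fin K → ℝ) (x : ℝ) : ℝ := ∑ k : Fin K, h k * x ^ (k : ℕ)

/-! ### Eigenvalues -/

/-- The `k`-th largest positive eigenvalue (`k ≥ 1`), counted with multiplicity, of a compact
self-adjoint operator `T`; it is `0` if `T` has fewer than `k` positive eigenvalues. Explicitly: the
largest eigenvalue `μ > 0` such that at least `k` eigenvalues, with multiplicity, are `≥ μ`. -/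
def posEigenvalue (T : L2I →L[ℝ] L2I) (k : ℕ) : ℝ :=
  sSup (insert 0 {μ : ℝ | 0 < μ ∧ Module.End.HasEigenvalue (T : Module.End ℝ L2I) μ ∧
    (k : Cardinal) ≤ Module.rank ℝ
      (⨆ ν ∈ Set.Ici μ, Module.End.eigenspace (T : Module.End ℝ L2I) ν : Submodule ℝ L2I)})

/-- The eigenvalues `λᵢ`, `i ∈ ℤ \ {0}`, of `T_W`, repeated according to multiplicity and ordered
by sign and decreasing absolute value: `λ₁ ≥ λ₂ ≥ … ≥ 0 ≥ … ≥ λ₋₂ ≥ λ₋₁`. -/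
def Graphon.eigenvalue (W : Graphon) (i : {i : ℤ // i ≠ 0}) : ℝ :=
  if 0 < i.1 then posEigenvalue W.shift i.1.natAbs else -posEigenvalue (-W.shift) i.1.natAbs

/-- The `c`-band cardinality `B^c_W`: the number of eigenvalues `λᵢ` with `|λᵢ| ≥ c`. -/
def Graphon.bandCard (W : Graphon) (c : ℝ) : ℕ :=
  {i : {i : ℤ // i ≠ 0} | c ≤ |W.eigenvalue i|}.ncard

/-- The `c`-eigenvalue margin
`δ^c_{W W'} = min_{i, j ≠ i} { |λᵢ(T_{W'}) - λⱼ(T_W)| : |λᵢ(T_{W'})| ≥ c }`. -/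
def eigenvalueMargin (W W' : Graphon) (c : ℝ) : ℝ :=
  sInf {d : ℝ | ∃ i j : {i : ℤ // i ≠ 0}, j ≠ i ∧ c ≤ |W'.eigenvalue i| ∧
    d = |W'.eigenvalue i - W.eigenvalue j|}

/-! ### Graphs, and the graphons and signals they induce -/

/-- A weighted undirected graph on `n` nodes, with graph shift operator `S` and weights in
`[0,1]`. -/
structure WGraph (n : ℕ) where
  /-- the graph shift operator -/
  S : Matrix (Fin n) (Fin n) ℝ
  symm : ∀ i j, S i j = S j i
  nonneg : ∀ i j, 0 ≤ S i j
  le_one : ∀ i j, S i j ≤ 1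

/-- The node label `uᵢ = (i-1)/n` of the regular partition (`i/n` for `i` counted from `0`). -/
def node {n : ℕ} (i : Fin n) : I :=
  ⟨(i : ℝ) / n, by positivity, by
    have : (i : ℝ) ≤ n := by exact_mod_cast i.2.le
    exact div_le_one_of_le₀ this (by positivity)⟩

/-- The interval `I_i = [uᵢ, uᵢ₊₁)` of the regular partition; the last one is closed: `[uₙ, 1]`. -/
def cell {n : ℕ} (i : Fin n) : Set I :=
  {u | (i : ℝ) / n ≤ u ∧ ((u : ℝ) < ((i : ℝ) + 1) / n ∨ (i : ℕ) + 1 = n)}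

lemma measurableSet_cell {n : ℕ} (i : Fin n) : MeasurableSet (cell i) := by
  have h1 : MeasurableSet {u : I | (i : ℝ) / n ≤ u} :=
    measurableSet_le measurable_const measurable_subtype_coe
  have h2 : MeasurableSet {u : I | (u : ℝ) < ((i : ℝ) + 1) / n} :=
    measurableSet_lt measurable_subtype_coe measurable_const
  exact h1.inter (h2.union (MeasurableSet.const _))

/-- The indicator function of `I_i`. -/
def cellInd {n : ℕ} (i : Fin n) : I → ℝ := (cell i).indicator 1

lemma measurable_cellInd {n : ℕ} (i : Fin n) : Measurable (cellInd i) :=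
  measurable_one.indicator (measurableSet_cell i)

lemma cellInd_nonneg {n : ℕ} (i : Fin n) (u : I) : 0 ≤ cellInd i u :=
  Set.indicator_nonneg (fun _ _ => zero_le_one) u

lemma cell_index_le {n : ℕ} {i j : Fin n} {u : I} (hi : u ∈ cell i) (hj : u ∈ cell j) :
    i ≤ j := by
  have hn : (0 : ℝ) < n := by exact_mod_cast i.pos
  rcases hj.2 with h | h
  · have h3 : (i : ℝ) < (j : ℝ) + 1 := (div_lt_div_iff_of_pos_right hn).1 (hi.1.trans_lt h)
    have : (i : ℕ) < j + 1 := by exact_mod_cast h3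
    exact Fin.le_def.2 (by omega)
  · exact Fin.le_def.2 (by omega)

lemma sum_cellInd_le_one {n : ℕ} (u : I) : ∑ i : Fin n, cellInd i u ≤ 1 := by
  by_cases h : ∃ i : Fin n, u ∈ cell i
  · obtain ⟨i, hi⟩ := h
    rw [Finset.sum_eq_single i]
    · simp [cellInd, hi]
    · intro j _ hj
      refine Set.indicator_of_notMem (fun hu => hj ?_) _
      exact le_antisymm (cell_index_le hu hi) (cell_index_le hi hu)
    · simp
  · push Not at h
    rw [Finset.sum_eq_zero fun i _ => show cellInd i u = 0 from Set.indicator_of_notMem (h i) _]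
    exact zero_le_one

/-- The graphon induced by a graph: `W_G(u,v) = ∑ᵢ ∑ⱼ S_{ij} 1(u ∈ I_i) 1(v ∈ I_j)`. -/
def WGraph.inducedGraphon {n : ℕ} (G : WGraph n) : Graphon where
  toFun u v := ∑ i, ∑ j, G.S i j * cellInd i u * cellInd j v
  measurable_toFun := by
    refine Finset.measurable_sum _ fun i _ => Finset.measurable_sum _ fun j _ => ?_
    exact (((measurable_cellInd i).comp measurable_fst).const_mul _).mul
      ((measurable_cellInd j).comp measurable_snd)
  symm u v := by
    rw [Finset.sum_comm]
    refine Finset.sum_congr rfl fun i _ => Finset.sum_congr rfl fun j _ => ?_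
    rw [G.symm]
    ring
  nonneg u v := Finset.sum_nonneg fun i _ => Finset.sum_nonneg fun j _ =>
    mul_nonneg (mul_nonneg (G.nonneg i j) (cellInd_nonneg i u)) (cellInd_nonneg j v)
  le_one u v := by
    have h1 : ∑ i, ∑ j, G.S i j * cellInd i u * cellInd j v
        ≤ (∑ i : Fin n, cellInd i u) * ∑ j : Fin n, cellInd j v := by
      rw [Finset.sum_mul_sum]
      refine Finset.sum_le_sum fun i _ => Finset.sum_le_sum fun j _ => ?_
      refine mul_le_mul_of_nonneg_right ?_ (cellInd_nonneg j v)
      simpa using mul_le_mul_of_nonneg_right (G.le_one i j) (cellInd_nonneg i u)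
    refine h1.trans ?_
    exact mul_le_one₀ (sum_cellInd_le_one u)
      (Finset.sum_nonneg fun j _ => cellInd_nonneg j v) (sum_cellInd_le_one v)

/-- The graphon signal induced by a graph signal: `X_n(u) = ∑ᵢ xᵢ 1(u ∈ I_i)`. -/
def inducedSignal {n : ℕ} (x : Fin n → ℝ) : GraphonSignal where
  toFun u := ∑ i, x i * cellInd i u
  memLp := by
    refine MemLp.of_bound (C := ∑ i, |x i|)
      (Finset.measurable_sum _ fun i _ =>
        (measurable_cellInd i).const_mul _).aestronglyMeasurable
      (Filter.Eventually.of_forall fun u => ?_)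
    refine (norm_sum_le _ _).trans (Finset.sum_le_sum fun i _ => ?_)
    rw [norm_mul, Real.norm_eq_abs, Real.norm_eq_abs, abs_of_nonneg (cellInd_nonneg i u)]
    refine mul_le_of_le_one_right (abs_nonneg _) ?_
    exact (Finset.single_le_sum (fun j _ => cellInd_nonneg j u) (Finset.mem_univ i)).trans
      (sum_cellInd_le_one u)

/-- The output of the graphon filter induced by the graph filter `Φ(x; h, S) = ∑ₖ hₖ S^k x`, namely
`Φ(X_n; h, W_G)`, where `W_G` is the graphon induced by the graph and `X_n` is the graphon signal
induced by the graph signal `x`. -/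
def WGraph.inducedFilterOutput {n : ℕ} (G : WGraph n) {K : ℕ} (h : Fin K → ℝ) (x : Fin n → ℝ) :
    L2I :=
  G.inducedGraphon.filter h (inducedSignal x).toL2

/-- The `n`-node template graph of `W`: `S_{ij} = W(uᵢ, uⱼ)` at the labels `uᵢ = (i-1)/n`. -/
def Graphon.templateGraph (W : Graphon) (n : ℕ) : WGraph n where
  S i j := W.toFun (node i) (node j)
  symm _ _ := W.symm _ _
  nonneg _ _ := W.nonneg _ _
  le_one _ _ := W.le_one _ _

/-- The graph signal generated by `X` on the `n`-node template graph: `xᵢ = X((i-1)/n)`. -/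
def GraphonSignal.sample (X : GraphonSignal) (n : ℕ) : Fin n → ℝ := fun i => X.toFun (node i)

/-! ### Lipschitz assumptions -/

/-- The graphon is `A`-Lipschitz. -/
def Graphon.IsLipschitz (W : Graphon) (A : ℝ) : Prop :=
  ∀ u₁ v₁ u₂ v₂ : I,
    |W.toFun u₂ v₂ - W.toFun u₁ v₁| ≤ A * (|(u₂ : ℝ) - u₁| + |(v₂ : ℝ) - v₁|)

/-- The graphon signal is `A`-Lipschitz. -/
def GraphonSignal.IsLipschitz (X : GraphonSignal) (A : ℝ) : Prop :=
  ∀ u₁ u₂ : I, |X.toFun u₂ - X.toFun u₁| ≤ A * |(u₂ : ℝ) - u₁|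

/-- The real function `f` is `A`-Lipschitz on the set `s`. -/
def IsLipschitzOnReal (f : ℝ → ℝ) (A : ℝ) (s : Set ℝ) : Prop :=
  ∀ x ∈ s, ∀ y ∈ s, |f x - f y| ≤ A * |x - y|

/-- The assumption on a spectral response `h` at the threshold `c`: it is `A`-Lipschitz on
`[-1,-c] ∪ [c,1]` and `a`-Lipschitz on `(-c,c)` with `a < A`, and `|h| < 1` on `[-1,1]`, the range
of graphon eigenvalues. -/
structure FilterAssumption (h : ℝ → ℝ) (A a c : ℝ) : Prop where
  lipschitz_outer : IsLipschitzOnReal h A (Set.Icc (-1) (-c) ∪ Set.Icc c 1)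
  lipschitz_inner : IsLipschitzOnReal h a (Set.Ioo (-c) c)
  lt : a < A
  abs_lt_one : ∀ x ∈ Set.Icc (-1 : ℝ) 1, |h x| < 1

end

/-! The proof gives the sharper bound `A_h * (2 * A_w / n) * ‖X‖ + A_x / n`; everything else on the
right-hand side is nonnegative, so neither the eigenvalue margin nor any matching of eigenvalues of
the two graphons is needed.

The filter is `p(T_W)` for a real polynomial `p` that is `A_h`-Lipschitz on all of `[-1,1]`, since
its Lipschitz pieces meet at `-c` and `c`. Lipschitz functions are in general not operator Lipschitz
with the same constant in operator norm, but they are in Hilbert-Schmidt norm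
(`norm_aeval_sub_aeval_apply_le`): if `B b = μ b`, then `(p(A) - p(B)) b = (p(A) - p(μ)) b`, and the
spectral theorem for `A` bounds its norm by `L ‖(A - μ) b‖ = L ‖(A - B) b‖`. Summing squares over an
eigenbasis of `B` gives the claim.

The Hilbert-Schmidt norm of `T_{W_n} - T_W` is at most the supremum of `|W_n - W|`
(`Graphon.sum_norm_sq_shift_sub_shift_le`), which is at most `2 * A_w / n`. Replacing `X` by its
step function costs at most `A_x / n`, because `|p| ≤ 1` on `[-1,1]` makes the filter a contraction.
-/

/-! ### Polynomials of compact symmetric operators -/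

section HilbertSpace

universe u

variable {E : Type u} [NormedAddCommGroup E] [InnerProductSpace ℝ E]

/-- Spectral theorem: a compact symmetric operator has a Hilbert basis of eigenvectors. -/
lemma exists_hilbertBasis_eigenvectors [CompleteSpace E] (T : E →L[ℝ] E) (hT : IsCompactOperator T)
    (hS : (T : E →ₗ[ℝ] E).IsSymmetric) :
    ∃ (ι : Type u) (b : HilbertBasis ι ℝ E) (μ : ι → ℝ), ∀ i, T (b i) = μ i • b i := by
  let V : ℝ → Submodule ℝ E := fun μ => Module.End.eigenspace (T : Module.End ℝ E) μ
  have hV : OrthogonalFamily ℝ (fun μ => V μ) fun μ => (V μ).subtypeₗᵢ :=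
    hS.orthogonalFamily_eigenspaces
  have hclosed : ∀ μ, IsClosed (V μ : Set E) := fun μ => by
    have : (V μ : Set E) = {x | T x = μ • x} := by
      ext x
      exact Module.End.mem_eigenspace_iff
    rw [this]
    exact isClosed_eq T.continuous (continuous_const_smul μ)
  have hcomp : ∀ μ, CompleteSpace (V μ) := fun μ => (hclosed μ).completeSpace_coe
  choose w b hb using fun μ => exists_hilbertBasis ℝ (V μ)
  have hortho : Orthonormal ℝ fun a : Σ μ, w μ => ((b a.1 a.2 : V a.1) : E) :=
    hV.orthonormal_sigma_orthonormal fun μ => (b μ).orthonormal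
  have hbot : (Submodule.span ℝ
      (Set.range fun a : Σ μ, w μ => ((b a.1 a.2 : V a.1) : E)))ᗮ = ⊥ := by
    -- Compactness enters here: the eigenspaces span a dense subspace, so it suffices that a vector
    -- orthogonal to all chosen basis vectors is orthogonal to every eigenspace.
    rw [eq_bot_iff, ← ContinuousLinearMap.orthogonalComplement_iSup_eigenspaces_eq_bot hT hS]
    intro x hx
    rw [Submodule.mem_orthogonal] at hx ⊢
    intro y hy
    refine Submodule.iSup_induction _ (motive := fun y => inner ℝ y x = 0) hy ?_ (by simp) ?_
    · intro μ y hy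
      have h1 := (((b μ).hasSum_repr ⟨y, hy⟩).mapL (V μ).subtypeL : _)
      have h2 := h1.mapL (innerSL ℝ x)
      have h3 : ∀ i, inner ℝ x ((b μ i : V μ) : E) = 0 := fun i => by
        rw [real_inner_comm]
        exact hx _ (Submodule.subset_span ⟨⟨μ, i⟩, rfl⟩)
      have h4 : inner ℝ x y = 0 := h2.unique (hasSum_zero.congr_fun fun i => ?_)
      · rwa [real_inner_comm]
      · simp [h3]
    · intro y z hy hz
      rw [inner_add_left, hy, hz, add_zero]
  refine ⟨Σ μ, w μ, HilbertBasis.mkOfOrthogonalEqBot hortho hbot, fun a => a.1, fun a => ?_⟩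
  rw [HilbertBasis.coe_mkOfOrthogonalEqBot]
  exact Module.End.mem_eigenspace_iff.1 (b a.1 a.2).2

lemma aeval_apply_of_apply_eq_smul (T : E →L[ℝ] E) {x : E} {μ : ℝ} (hx : T x = μ • x)
    (p : Polynomial ℝ) : Polynomial.aeval T p x = p.eval μ • x := by
  have hpow : ∀ k : ℕ, (T ^ k) x = μ ^ k • x := fun k => by
    induction k with
    | zero => simp
    | succ k ih => rw [pow_succ, mul_apply_eq_comp, hx, map_smul, ih, smul_smul, pow_succ']
  induction p using Polynomial.induction_on' with
  | add p q hp hq => rw [map_add, add_apply, hp, hq, Polynomial.eval_add, add_smul]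
  | monomial k a =>
    rw [Polynomial.aeval_monomial, Polynomial.eval_monomial, mul_apply_eq_comp, hpow,
      map_smul, Algebra.algebraMap_eq_smul_one]
    simp [smul_smul, mul_comm]

lemma HilbertBasis.hasSum_sq_inner {ι : Type*} (b : HilbertBasis ι ℝ E) (x : E) :
    HasSum (fun i => inner ℝ (b i) x ^ 2) (‖x‖ ^ 2) := by
  have := b.hasSum_inner_mul_inner x x
  rw [real_inner_self_eq_norm_sq] at this
  refine this.congr_fun fun i => ?_
  rw [real_inner_comm, sq]

/-- Polynomial functional calculus of a compact symmetric contraction is monotone in the absolute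
value of the polynomial on `[-1,1]`. -/
lemma norm_aeval_apply_le [CompleteSpace E] (T : E →L[ℝ] E) (hT : IsCompactOperator T)
    (hS : (T : E →ₗ[ℝ] E).IsSymmetric) (hT1 : ‖T‖ ≤ 1) {p q : Polynomial ℝ}
    (hpq : ∀ x ∈ Set.Icc (-1 : ℝ) 1, |p.eval x| ≤ |q.eval x|) (x : E) :
    ‖Polynomial.aeval T p x‖ ≤ ‖Polynomial.aeval T q x‖ := by
  obtain ⟨ι, b, μ, hb⟩ := exists_hilbertBasis_eigenvectors T hT hS
  have hμ : ∀ i, μ i ∈ Set.Icc (-1 : ℝ) 1 := fun i => by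
    have h1 := T.le_opNorm (b i)
    rw [hb, norm_smul, b.orthonormal.1 i, mul_one, mul_one, Real.norm_eq_abs] at h1
    exact abs_le.1 (h1.trans hT1)
  -- In the eigenbasis `p(T)` is diagonal with entries `p(μ i)`, so by Parseval the norms compare
  -- coefficient by coefficient.
  have hcoef : ∀ (p : Polynomial ℝ) (i : ι),
      inner ℝ (b i) (Polynomial.aeval T p x) = p.eval (μ i) * inner ℝ (b i) x := fun p i => by
    have h : HasSum (fun j => b.repr x j • p.eval (μ j) • b j) (Polynomial.aeval T p x) := by
      have := (b.hasSum_repr x).mapL (Polynomial.aeval T p)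
      simpa [aeval_apply_of_apply_eq_smul T (hb _)] using this
    have h2 := h.mapL (innerSL ℝ (b i))
    have h3 := hasSum_single (f := fun j => innerSL ℝ (b i) (b.repr x j • p.eval (μ j) • b j)) i
      fun j hj => by
        simp [b.orthonormal.2 hj.symm]
    have h4 := h2.unique h3
    simpa [inner_smul_right, b.repr_apply_apply, b.orthonormal.1 i, mul_comm] using h4
  refine (sq_le_sq₀ (norm_nonneg _) (norm_nonneg _)).1 ?_
  refine hasSum_le (fun i => ?_) (b.hasSum_sq_inner _) (b.hasSum_sq_inner _)
  rw [hcoef, hcoef, mul_pow, mul_pow]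
  exact mul_le_mul_of_nonneg_right (sq_le_sq.2 (hpq _ (hμ i))) (sq_nonneg _)

/-- A polynomial that is Lipschitz on `[-1,1]` is operator Lipschitz with the same constant in
Hilbert-Schmidt norm. -/
lemma norm_aeval_sub_aeval_apply_le [CompleteSpace E] (A B : E →L[ℝ] E) (hA : IsCompactOperator A)
    (hB : IsCompactOperator B) (hAS : (A : E →ₗ[ℝ] E).IsSymmetric)
    (hBS : (B : E →ₗ[ℝ] E).IsSymmetric) (hA1 : ‖A‖ ≤ 1) (hB1 : ‖B‖ ≤ 1) {p : Polynomial ℝ}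
    {L ε : ℝ} (hL : 0 ≤ L) (hε : 0 ≤ ε)
    (hp : ∀ x ∈ Set.Icc (-1 : ℝ) 1, ∀ y ∈ Set.Icc (-1 : ℝ) 1,
      |p.eval x - p.eval y| ≤ L * |x - y|)
    -- The Hilbert-Schmidt bound on `A - B`, asked of every orthonormal family because the
    -- eigenbasis of `B` is only chosen inside the proof.
    (hAB : ∀ (ι : Type u) (f : ι → E), Orthonormal ℝ f → ∀ s : Finset ι,
      ∑ i ∈ s, ‖A (f i) - B (f i)‖ ^ 2 ≤ ε ^ 2) (x : E) :
    ‖Polynomial.aeval A p x - Polynomial.aeval B p x‖ ≤ L * ε * ‖x‖ := by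
  obtain ⟨ι, b, μ, hb⟩ := exists_hilbertBasis_eigenvectors B hB hBS
  have hμ : ∀ i, μ i ∈ Set.Icc (-1 : ℝ) 1 := fun i => by
    have h1 := B.le_opNorm (b i)
    rw [hb, norm_smul, b.orthonormal.1 i, mul_one, mul_one, Real.norm_eq_abs] at h1
    exact abs_le.1 (h1.trans hB1)
  set D : E →L[ℝ] E := Polynomial.aeval A p - Polynomial.aeval B p with hD
  have hDb : ∀ i, ‖D (b i)‖ ≤ L * ‖A (b i) - B (b i)‖ := fun i => by
    -- The Lipschitz condition at `μ i` reads `|p - p(μ i)| ≤ |L (X - μ i)|` on `[-1,1]`. Evaluated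
    -- at `A` and applied to `b i`, the two sides become `D (b i)` and `L • (A - B) (b i)`.
    have h := norm_aeval_apply_le A hA hAS hA1 (p := p - Polynomial.C (p.eval (μ i)))
      (q := Polynomial.C L * (Polynomial.X - Polynomial.C (μ i)))
      (fun y hy => by
        simpa [abs_mul, abs_of_nonneg hL] using hp y hy _ (hμ i)) (b i)
    have h1 : Polynomial.aeval A (p - Polynomial.C (p.eval (μ i))) (b i) = D (b i) := by
      simp [hD, aeval_apply_of_apply_eq_smul B (hb i), Algebra.algebraMap_eq_smul_one]
    have h2 : Polynomial.aeval A (Polynomial.C L * (Polynomial.X - Polynomial.C (μ i))) (b i)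
        = L • (A (b i) - B (b i)) := by
      simp [hb i, Algebra.algebraMap_eq_smul_one]
    rwa [h1, h2, norm_smul, Real.norm_eq_abs, abs_of_nonneg hL] at h
  have hsum := (b.hasSum_repr x).mapL D
  refine le_of_tendsto hsum.norm (Filter.Eventually.of_forall fun s => ?_)
  have hx : ∑ i ∈ s, |b.repr x i| ^ 2 ≤ ‖x‖ ^ 2 := by
    have := sum_le_hasSum s (fun i _ => sq_nonneg _) (b.hasSum_sq_inner x)
    simpa [b.repr_apply_apply] using this
  have hDs : ∑ i ∈ s, ‖D (b i)‖ ^ 2 ≤ (L * ε) ^ 2 := by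
    calc ∑ i ∈ s, ‖D (b i)‖ ^ 2 ≤ ∑ i ∈ s, L ^ 2 * ‖A (b i) - B (b i)‖ ^ 2 :=
          Finset.sum_le_sum fun i _ => by
            rw [← mul_pow]
            exact pow_le_pow_left₀ (norm_nonneg _) (hDb i) 2
      _ ≤ (L * ε) ^ 2 := by
          rw [← Finset.mul_sum, mul_pow]
          exact mul_le_mul_of_nonneg_left (hAB ι b b.orthonormal s) (sq_nonneg L)
  have hLε : 0 ≤ L * ε := mul_nonneg hL hε
  calc ‖∑ i ∈ s, D (b.repr x i • b i)‖ ≤ ∑ i ∈ s, |b.repr x i| * ‖D (b i)‖ :=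
        (norm_sum_le _ _).trans_eq (Finset.sum_congr rfl fun i _ => by
          rw [map_smul, norm_smul, Real.norm_eq_abs])
    _ ≤ L * ε * ‖x‖ := by
        -- Cauchy-Schwarz between the coefficients of `x` and the norms `‖D (b i)‖`.
        refine abs_le_of_sq_le_sq' ?_ (mul_nonneg hLε (norm_nonneg x)) |>.2
        refine (Finset.sum_mul_sq_le_sq_mul_sq s _ _).trans ?_
        rw [mul_pow (L * ε), mul_comm]
        exact mul_le_mul hDs hx (Finset.sum_nonneg fun i _ => sq_nonneg _) (sq_nonneg _)

/-- An operator with range in a finite-dimensional subspace is compact. -/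
lemma isCompactOperator_of_forall_mem (T : E →L[ℝ] E) (V : Submodule ℝ E)
    [FiniteDimensional ℝ V] (hV : ∀ x, T x ∈ V) : IsCompactOperator T :=
  by
  have : IsCompactOperator (T.codRestrict V hV) := isCompactOperator_of_locallyCompactSpace_dom _
  exact this.clm_comp V.subtypeL

end HilbertSpace

/-! ### Graphon shift operators and their Hilbert-Schmidt distance -/

noncomputable section

namespace Graphon

lemma shift_ae_eq (W : Graphon) (f : L2I) : W.shift f =ᵐ[volume] W.shiftFun f :=
  (W.memLp_shiftFun f).coeFn_toLp

lemma norm_shift_le_one (W : Graphon) : ‖W.shift‖ ≤ 1 :=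
  LinearMap.mkContinuous_norm_le _ zero_le_one _

lemma inner_shift_left (W : Graphon) (f g : L2I) :
    inner ℝ (W.shift f) g = ∫ v, ∫ u, W.toFun u v * ((f : I → ℝ) u * (g : I → ℝ) v) := by
  rw [L2.inner_def]
  refine integral_congr_ae ?_
  filter_upwards [W.shift_ae_eq f] with v hv
  rw [hv, shiftFun, real_inner_comm, RCLike.inner_apply, conj_trivial, ← integral_mul_const]
  exact integral_congr_ae (Filter.Eventually.of_forall fun u => by ring)

lemma integrable_kernel_mul_mul (W : Graphon) (f g : L2I) :
    Integrable (Function.uncurry fun v u : I => W.toFun u v * ((f : I → ℝ) u * (g : I → ℝ) v))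
      (volume.prod volume) := by
  have h := (integrable_coe g).mul_prod (integrable_coe f)
  refine (h.bdd_mul (c := 1) (f := fun p : I × I => W.toFun p.2 p.1) ?_ ?_).congr ?_
  · exact (W.measurable_toFun.comp (measurable_snd.prodMk measurable_fst)).aestronglyMeasurable
  · exact Filter.Eventually.of_forall fun p => W.abs_le_one p.2 p.1
  · exact Filter.Eventually.of_forall fun p => by
      simp only [Function.uncurry]
      ring

/-- Fubini and the symmetry of the kernel. -/
lemma isSymmetric_shift (W : Graphon) : (W.shift : L2I →ₗ[ℝ] L2I).IsSymmetric := fun f g => by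
  change inner ℝ (W.shift f) g = inner ℝ f (W.shift g)
  rw [real_inner_comm _ f, inner_shift_left, inner_shift_left,
    integral_integral_swap (W.integrable_kernel_mul_mul f g)]
  refine integral_congr_ae (Filter.Eventually.of_forall fun u => ?_)
  refine integral_congr_ae (Filter.Eventually.of_forall fun v => ?_)
  simp only [W.symm u v]
  ring

section Difference

variable (W W' : Graphon)

lemma memLp_kernel_sub (v : I) :
    MemLp (fun u => W.toFun u v - W'.toFun u v) 2 (volume : Measure I) := by
  refine MemLp.of_bound (C := 1 + 1) ?_ (Filter.Eventually.of_forall fun u =>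
    (norm_sub_le _ _).trans (add_le_add (W.abs_le_one u v) (W'.abs_le_one u v)))
  have hm : Measurable fun u : I => (u, v) := measurable_id.prodMk measurable_const
  exact ((W.measurable_toFun.comp hm).sub (W'.measurable_toFun.comp hm)).aestronglyMeasurable

/-- The class in `L₂` of the section `u ↦ W(u,v) - W'(u,v)`. -/
def kernelSub (v : I) : L2I := (memLp_kernel_sub W W' v).toLp

lemma norm_kernelSub_le {ε : ℝ} (hε : 0 ≤ ε) (h : ∀ u v, |W.toFun u v - W'.toFun u v| ≤ ε) (v : I) :
    ‖kernelSub W W' v‖ ≤ ε := by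
  have := Lp.norm_le_of_ae_bound (f := kernelSub W W' v) hε (by
    filter_upwards [(memLp_kernel_sub W W' v).coeFn_toLp] with u hu
    rw [kernelSub, hu]
    exact h u v)
  simpa [measureUnivNNReal] using this

/-- Writing the difference as an inner product with a kernel section makes Bessel's inequality
available at each fixed `v`. -/
lemma shiftFun_sub_shiftFun (f : L2I) (v : I) :
    W.shiftFun f v - W'.shiftFun f v = inner ℝ f (kernelSub W W' v) := by
  rw [shiftFun, shiftFun, ← integral_sub (W.integrable_mul f v) (W'.integrable_mul f v),
    L2.inner_def]
  refine integral_congr_ae ?_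
  filter_upwards [(memLp_kernel_sub W W' v).coeFn_toLp] with u hu
  rw [kernelSub, hu, RCLike.inner_apply, conj_trivial]
  ring

lemma shift_sub_shift_ae_eq (f : L2I) :
    (W.shift f - W'.shift f : L2I) =ᵐ[volume] fun v => inner ℝ f (kernelSub W W' v) := by
  filter_upwards [Lp.coeFn_sub (W.shift f) (W'.shift f), W.shift_ae_eq f, W'.shift_ae_eq f]
    with v h h1 h2
  rw [h, Pi.sub_apply, h1, h2, shiftFun_sub_shiftFun]

variable {W W'}

/-- Serves to obtain `T_W` as a norm limit of finite-rank operators; the error estimate itself uses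
the Hilbert-Schmidt bound. -/
lemma norm_shift_sub_shift_le {ε : ℝ} (hε : 0 ≤ ε)
    (h : ∀ u v, |W.toFun u v - W'.toFun u v| ≤ ε) : ‖W.shift - W'.shift‖ ≤ ε := by
  refine ContinuousLinearMap.opNorm_le_bound _ hε fun f => ?_
  have := Lp.norm_le_of_ae_bound (f := W.shift f - W'.shift f)
    (mul_nonneg hε (norm_nonneg f)) (by
      filter_upwards [shift_sub_shift_ae_eq W W' f] with v hv
      rw [hv, mul_comm]
      exact (norm_inner_le_norm _ _).trans
        (mul_le_mul_of_nonneg_left (norm_kernelSub_le W W' hε h v) (norm_nonneg f)))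
  simpa [measureUnivNNReal] using this

/-- The Hilbert-Schmidt norm of `T_W - T_W'` is at most `sup |W - W'|`. -/
lemma sum_norm_sq_shift_sub_shift_le {ε : ℝ} (hε : 0 ≤ ε)
    (h : ∀ u v, |W.toFun u v - W'.toFun u v| ≤ ε) {ι : Type*} {f : ι → L2I}
    (hf : Orthonormal ℝ f) (s : Finset ι) :
    ∑ i ∈ s, ‖W.shift (f i) - W'.shift (f i)‖ ^ 2 ≤ ε ^ 2 := by
  have hnorm : ∀ i, ‖W.shift (f i) - W'.shift (f i)‖ ^ 2
      = ∫ v, inner ℝ (f i) (kernelSub W W' v) ^ 2 := fun i => by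
    rw [← real_inner_self_eq_norm_sq, L2.inner_def]
    refine integral_congr_ae ?_
    filter_upwards [shift_sub_shift_ae_eq W W' (f i)] with v hv
    rw [hv, real_inner_self_eq_norm_sq, Real.norm_eq_abs, sq_abs]
  have hint : ∀ i, Integrable (fun v => inner ℝ (f i) (kernelSub W W' v) ^ 2)
      (volume : Measure I) := fun i =>
    ((memLp_congr_ae (shift_sub_shift_ae_eq W W' (f i))).1 (Lp.memLp _)).integrable_sq
  rw [Finset.sum_congr rfl fun i _ => hnorm i, ← integral_finsetSum _ fun i _ => hint i]
  calc ∫ v, ∑ i ∈ s, inner ℝ (f i) (kernelSub W W' v) ^ 2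
      ≤ ∫ _ : I, ε ^ 2 := by
        refine integral_mono (integrable_finsetSum _ fun i _ => hint i) (integrable_const _)
          fun v => ?_
        -- Bessel's inequality for the section at `v`, whose norm is at most `ε`; integrating over a
        -- probability space keeps `ε ^ 2`.
        have h1 := hf.sum_inner_products_le (kernelSub W W' v) (s := s)
        simp only [Real.norm_eq_abs, sq_abs] at h1
        exact h1.trans (pow_le_pow_left₀ (norm_nonneg _) (norm_kernelSub_le W W' hε h v) 2)
    _ = ε ^ 2 := by simp

end Difference

end Graphon

/-! ### The regular partition and step kernels -/

section Cells

variable {n : ℕ}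

lemma exists_mem_cell (hn : 1 ≤ n) (u : I) : ∃ i : Fin n, u ∈ cell i := by
  have hn0 : (0 : ℝ) < n := by exact_mod_cast hn
  have hun : 0 ≤ (u : ℝ) * n := mul_nonneg u.2.1 hn0.le
  by_cases h : ⌊(u : ℝ) * n⌋₊ < n
  · refine ⟨⟨_, h⟩, ?_, Or.inl ?_⟩
    · exact (div_le_iff₀ hn0).2 (Nat.floor_le hun)
    · exact (lt_div_iff₀ hn0).2 (Nat.lt_floor_add_one _)
  -- Only `u = 1` reaches this case; it belongs to the last cell, which is closed.
  · refine ⟨⟨n - 1, by omega⟩, ?_, Or.inr (by simp; omega)⟩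
    have h1 : (n : ℝ) ≤ u * n := (Nat.le_floor_iff hun).1 (not_lt.1 h)
    rw [div_le_iff₀ hn0]
    refine le_trans ?_ h1
    exact_mod_cast Nat.sub_le n 1

lemma abs_sub_node_le {i : Fin n} {u : I} (hu : u ∈ cell i) : |(u : ℝ) - (node i : I)| ≤ 1 / n := by
  have hn0 : (0 : ℝ) < n := by exact_mod_cast i.pos
  have h0 : (i : ℝ) / n ≤ u := hu.1
  have h1 : (u : ℝ) ≤ ((i : ℝ) + 1) / n := by
    rcases hu.2 with h | h
    · exact h.le
    · have : (i : ℝ) + 1 = n := by exact_mod_cast h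
      rw [this, div_self hn0.ne']
      exact u.2.2
  rw [add_div] at h1
  change |(u : ℝ) - (i : ℝ) / n| ≤ 1 / n
  rw [abs_of_nonneg (by linarith)]
  linarith

lemma cellInd_eq_ite {i : Fin n} {u : I} (hu : u ∈ cell i) (j : Fin n) :
    cellInd j u = if j = i then 1 else 0 := by
  split_ifs with h
  · rw [h, cellInd, Set.indicator_of_mem hu, Pi.one_apply]
  · exact Set.indicator_of_notMem
      (fun hj => h (le_antisymm (cell_index_le hj hu) (cell_index_le hu hj))) _

lemma inducedGraphon_apply (G : WGraph n) {i j : Fin n} {u v : I} (hu : u ∈ cell i)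
    (hv : v ∈ cell j) : G.inducedGraphon.toFun u v = G.S i j := by
  simp [WGraph.inducedGraphon, cellInd_eq_ite hu, cellInd_eq_ite hv]

lemma inducedSignal_apply (x : Fin n → ℝ) {i : Fin n} {u : I} (hu : u ∈ cell i) :
    (inducedSignal x).toFun u = x i := by
  simp [inducedSignal, cellInd_eq_ite hu]

lemma memLp_cellInd (i : Fin n) : MemLp (cellInd i) 2 (volume : Measure I) :=
  MemLp.of_bound (measurable_cellInd i).aestronglyMeasurable 1
    (Filter.Eventually.of_forall fun u => by
      rw [Real.norm_eq_abs, abs_of_nonneg (cellInd_nonneg i u)]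
      exact (Finset.single_le_sum (fun j _ => cellInd_nonneg j u) (Finset.mem_univ i)).trans
        (sum_cellInd_le_one u))

/-- A step kernel is a finite sum of products of functions of `u` and of `v`, so the range lies in
the span of the cell indicators. -/
lemma isCompactOperator_shift_inducedGraphon (G : WGraph n) :
    IsCompactOperator G.inducedGraphon.shift := by
  let e : Fin n → L2I := fun j => (memLp_cellInd j).toLp
  have : FiniteDimensional ℝ (Submodule.span ℝ (Set.range e)) :=
    FiniteDimensional.span_of_finite ℝ (Set.finite_range e)
  refine isCompactOperator_of_forall_mem _ (Submodule.span ℝ (Set.range e)) fun f => ?_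
  let a : Fin n → ℝ := fun j => ∫ u, (∑ i, G.S i j * cellInd i u) * (f : I → ℝ) u
  have hint : ∀ j, Integrable (fun u => (∑ i, G.S i j * cellInd i u) * (f : I → ℝ) u) volume :=
    fun j => by
      have hm : MemLp (fun u => ∑ i, G.S i j * cellInd i u) 2 (volume : Measure I) :=
        memLp_finsetSum _ fun i _ => (memLp_cellInd i).const_mul _
      exact hm.integrable_mul (Lp.memLp f)
  have h : G.inducedGraphon.shift f = ∑ j, a j • e j := by
    refine Lp.ext ?_
    have h1 : ∀ᵐ v : I, ∀ j, (e j : I → ℝ) v = cellInd j v :=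
      ae_all_iff.2 fun j => (memLp_cellInd j).coeFn_toLp
    have h2 : ∀ᵐ v : I, ∀ j, ((a j • e j : L2I) : I → ℝ) v = a j • (e j : I → ℝ) v :=
      ae_all_iff.2 fun j => Lp.coeFn_smul _ _
    filter_upwards [G.inducedGraphon.shift_ae_eq f, h1, h2,
      Lp.coeFn_finsetSum Finset.univ fun j => a j • e j] with v hv h1 h2 h3
    rw [hv, h3, Finset.sum_apply]
    simp only [h2, h1, smul_eq_mul, a, ← integral_mul_const, Graphon.shiftFun]
    rw [← integral_finsetSum _ fun j _ => (hint j).mul_const _]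
    refine integral_congr_ae (Filter.Eventually.of_forall fun u => ?_)
    simp only [WGraph.inducedGraphon]
    rw [Finset.sum_comm, Finset.sum_mul]
    refine Finset.sum_congr rfl fun j _ => ?_
    rw [← Finset.sum_mul]
    ring
  rw [h]
  exact Submodule.sum_mem _ fun j _ =>
    Submodule.smul_mem _ _ (Submodule.subset_span (Set.mem_range_self j))

end Cells

end

/-! ### Gluing the Lipschitz conditions on the spectral response -/

section LipschitzOnReal

variable {f : ℝ → ℝ} {L : ℝ}

/-- Needed because the inner condition lives on the open interval `(-c,c)`, while gluing requires
the endpoints. -/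
lemma IsLipschitzOnReal.closure {s : Set ℝ} (h : IsLipschitzOnReal f L s) (hf : Continuous f) :
    IsLipschitzOnReal f L (closure s) := fun x hx y hy => by
  have hclosed : IsClosed {z : ℝ × ℝ | |f z.1 - f z.2| ≤ L * |z.1 - z.2|} :=
    isClosed_le (by fun_prop) (by fun_prop)
  have hsub : s ×ˢ s ⊆ {z : ℝ × ℝ | |f z.1 - f z.2| ≤ L * |z.1 - z.2|} :=
    fun z hz => h _ hz.1 _ hz.2
  have hxy : (x, y) ∈ _root_.closure (s ×ˢ s) := by
    rw [closure_prod_eq]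
    exact ⟨hx, hy⟩
  exact closure_minimal hsub hclosed hxy

lemma IsLipschitzOnReal.mono {s t : Set ℝ} (h : IsLipschitzOnReal f L t) (hst : s ⊆ t) :
    IsLipschitzOnReal f L s := fun x hx y hy => h x (hst hx) y (hst hy)

lemma IsLipschitzOnReal.mono_const {s : Set ℝ} {L' : ℝ} (h : IsLipschitzOnReal f L s)
    (hL : L ≤ L') : IsLipschitzOnReal f L' s := fun x hx y hy =>
  (h x hx y hy).trans (mul_le_mul_of_nonneg_right hL (abs_nonneg _))

lemma IsLipschitzOnReal.Icc_union_Icc {a b d : ℝ} (h₁ : IsLipschitzOnReal f L (Set.Icc a b))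
    (h₂ : IsLipschitzOnReal f L (Set.Icc b d)) : IsLipschitzOnReal f L (Set.Icc a d) := by
  have key : ∀ x y, a ≤ x → x ≤ b → b ≤ y → y ≤ d → |f x - f y| ≤ L * |x - y| := by
    intro x y hax hxb hby hyd
    have h1 := h₁ x ⟨hax, hxb⟩ b ⟨hax.trans hxb, le_rfl⟩
    have h2 := h₂ b ⟨le_rfl, hby.trans hyd⟩ y ⟨hby, hyd⟩
    rw [abs_sub_comm x b, abs_of_nonneg (sub_nonneg.2 hxb)] at h1
    rw [abs_sub_comm b y, abs_of_nonneg (sub_nonneg.2 hby)] at h2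
    rw [abs_sub_comm x y, abs_of_nonneg (sub_nonneg.2 (hxb.trans hby))]
    linarith [abs_sub_le (f x) (f b) (f y)]
  intro x hx y hy
  rcases le_total x b with hxb | hxb <;> rcases le_total y b with hyb | hyb
  · exact h₁ x ⟨hx.1, hxb⟩ y ⟨hy.1, hyb⟩
  · exact key x y hx.1 hxb hyb hy.2
  · rw [abs_sub_comm (f x), abs_sub_comm x]
    exact key y x hy.1 hyb hxb hx.2
  · exact h₂ x ⟨hxb, hx.2⟩ y ⟨hyb, hy.2⟩

lemma IsLipschitzOnReal.const_nonneg {s : Set ℝ} (h : IsLipschitzOnReal f L s) {x y : ℝ}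
    (hx : x ∈ s) (hy : y ∈ s) (hxy : x ≠ y) : 0 ≤ L :=
  nonneg_of_mul_nonneg_left ((abs_nonneg _).trans (h x hx y hy)) (abs_pos.2 (sub_ne_zero.2 hxy))

/-- Since `a < A`, the larger constant serves on `[-1,-c]`, `[-c,c]` and `[c,1]`, which share
endpoints. -/
lemma FilterAssumption.isLipschitzOnReal {A a c : ℝ} (h : FilterAssumption f A a c)
    (hf : Continuous f) (hc0 : 0 < c) : IsLipschitzOnReal f A (Set.Icc (-1) 1) := by
  have hin : IsLipschitzOnReal f A (Set.Icc (-c) c) := by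
    rw [← closure_Ioo (by linarith : -c ≠ c)]
    exact (h.lipschitz_inner.closure hf).mono_const h.lt.le
  exact ((h.lipschitz_outer.mono Set.subset_union_left).Icc_union_Icc hin).Icc_union_Icc
    (h.lipschitz_outer.mono Set.subset_union_right)

lemma FilterAssumption.inner_nonneg {A a c : ℝ} (h : FilterAssumption f A a c) (hc0 : 0 < c) :
    0 ≤ a :=
  h.lipschitz_inner.const_nonneg (x := 0) (y := c / 2) ⟨by linarith, hc0⟩
    ⟨by linarith, by linarith⟩ (by linarith)

end LipschitzOnReal

/-! ### Template approximation and the final estimate -/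

lemma Graphon.IsLipschitz.const_nonneg {W : Graphon} {A : ℝ} (h : W.IsLipschitz A) : 0 ≤ A := by
  have := (abs_nonneg _).trans (h 0 0 1 0)
  simpa using this

lemma GraphonSignal.IsLipschitz.const_nonneg {X : GraphonSignal} {A : ℝ} (h : X.IsLipschitz A) :
    0 ≤ A := by
  have := (abs_nonneg _).trans (h 0 1)
  simpa using this

/-- The polynomial whose evaluation is the spectral response of a filter. -/
noncomputable def filterPolynomial {K : ℕ} (h : Fin K → ℝ) : Polynomial ℝ :=
  ∑ k : Fin K, Polynomial.C (h k) * Polynomial.X ^ (k : ℕ)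

lemma eval_filterPolynomial {K : ℕ} (h : Fin K → ℝ) (x : ℝ) :
    (filterPolynomial h).eval x = spectralResponse h x := by
  simp [filterPolynomial, spectralResponse, Polynomial.eval_finsetSum]

lemma Graphon.filter_eq_aeval (W : Graphon) {K : ℕ} (h : Fin K → ℝ) :
    W.filter h = Polynomial.aeval W.shift (filterPolynomial h) := by
  simp [filterPolynomial, Graphon.filter, Algebra.smul_def]

lemma continuous_spectralResponse {K : ℕ} (h : Fin K → ℝ) : Continuous (spectralResponse h) := by
  unfold spectralResponse
  fun_prop

/-- Each of the two coordinates lies within `1 / n` of the label of its cell, hence the factor 2. -/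
lemma Graphon.IsLipschitz.abs_templateGraph_sub_le {W : Graphon} {A : ℝ} (hW : W.IsLipschitz A)
    {n : ℕ} (hn : 1 ≤ n) (u v : I) :
    |(W.templateGraph n).inducedGraphon.toFun u v - W.toFun u v| ≤ 2 * A / n := by
  obtain ⟨i, hi⟩ := exists_mem_cell hn u
  obtain ⟨j, hj⟩ := exists_mem_cell hn v
  rw [inducedGraphon_apply _ hi hj, abs_sub_comm]
  refine (hW (node i) (node j) u v).trans ((mul_le_mul_of_nonneg_left
    (add_le_add (abs_sub_node_le hi) (abs_sub_node_le hj)) hW.const_nonneg).trans_eq ?_)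
  ring

lemma GraphonSignal.IsLipschitz.norm_inducedSignal_sub_le {X : GraphonSignal} {A : ℝ}
    (hX : X.IsLipschitz A) {n : ℕ} (hn : 1 ≤ n) :
    ‖(inducedSignal (X.sample n)).toL2 - X.toL2‖ ≤ A / n := by
  have hA : 0 ≤ A / n := div_nonneg hX.const_nonneg (Nat.cast_nonneg n)
  have := Lp.norm_le_of_ae_bound (f := (inducedSignal (X.sample n)).toL2 - X.toL2) hA (by
    filter_upwards [Lp.coeFn_sub (inducedSignal (X.sample n)).toL2 X.toL2,
      (inducedSignal (X.sample n)).memLp.coeFn_toLp, X.memLp.coeFn_toLp] with u h h1 h2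
    rw [h, Pi.sub_apply, GraphonSignal.toL2, GraphonSignal.toL2, h1, h2]
    obtain ⟨i, hi⟩ := exists_mem_cell hn u
    rw [inducedSignal_apply _ hi, Real.norm_eq_abs, abs_sub_comm]
    refine (hX (node i) u).trans
      ((mul_le_mul_of_nonneg_left (abs_sub_node_le hi) hX.const_nonneg).trans_eq ?_)
    ring)
  simpa [measureUnivNNReal] using this

/-- The finite-rank template operators converge to `T_W` in operator norm at rate `2 * A / n`. -/
lemma Graphon.IsLipschitz.isCompactOperator_shift {W : Graphon} {A : ℝ} (hW : W.IsLipschitz A) :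
    IsCompactOperator W.shift := by
  refine isCompactOperator_of_tendsto (l := Filter.atTop)
    (F := fun n : ℕ => (W.templateGraph n).inducedGraphon.shift) ?_
    (Filter.Eventually.of_forall fun n => isCompactOperator_shift_inducedGraphon _)
  rw [tendsto_iff_norm_sub_tendsto_zero]
  refine squeeze_zero' (Filter.Eventually.of_forall fun n => norm_nonneg _) ?_
    (tendsto_const_div_atTop_nhds_zero_nat (2 * A))
  filter_upwards [Filter.eventually_ge_atTop 1] with n hn
  exact Graphon.norm_shift_sub_shift_le
    (div_nonneg (mul_nonneg zero_le_two hW.const_nonneg) (Nat.cast_nonneg n))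
    (hW.abs_templateGraph_sub_le hn)

lemma eigenvalueMargin_nonneg (W W' : Graphon) (c : ℝ) : 0 ≤ eigenvalueMargin W W' c :=
  Real.sInf_nonneg fun _ ⟨_, _, _, _, hd⟩ => hd ▸ abs_nonneg _

/-- Replacing a Lipschitz graphon and signal by their `n`-node templates changes the filter output
by at most `L (2A/n) ‖X‖ + A'/n`, where `L` is the Lipschitz constant of the spectral response. -/
theorem norm_inducedFilterOutput_sub_filter_le (W : Graphon) (X : GraphonSignal) {K : ℕ}
    (h : Fin K → ℝ) {A A' L : ℝ} (hW : W.IsLipschitz A) (hX : X.IsLipschitz A')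
    (hL : IsLipschitzOnReal (spectralResponse h) L (Set.Icc (-1) 1))
    (hone : ∀ x ∈ Set.Icc (-1 : ℝ) 1, |spectralResponse h x| ≤ 1) {n : ℕ} (hn : 1 ≤ n) :
    ‖(W.templateGraph n).inducedFilterOutput h (X.sample n) - W.filter h X.toL2‖ ≤
      L * (2 * A / n) * ‖X.toL2‖ + A' / n := by
  set G := W.templateGraph n
  set Xn := inducedSignal (X.sample n)
  have hG := isCompactOperator_shift_inducedGraphon G
  have h1 : ‖G.inducedGraphon.filter h X.toL2 - W.filter h X.toL2‖
      ≤ L * (2 * A / n) * ‖X.toL2‖ := by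
    rw [Graphon.filter_eq_aeval, Graphon.filter_eq_aeval]
    have hε : 0 ≤ 2 * A / n :=
      div_nonneg (mul_nonneg zero_le_two hW.const_nonneg) (Nat.cast_nonneg n)
    refine norm_aeval_sub_aeval_apply_le _ _ hG hW.isCompactOperator_shift
      (Graphon.isSymmetric_shift _) W.isSymmetric_shift (Graphon.norm_shift_le_one _)
      W.norm_shift_le_one
      (hL.const_nonneg (x := -1) (y := 1) (by simp) (by simp) (by norm_num)) hε ?_
      (fun ι f hf s => Graphon.sum_norm_sq_shift_sub_shift_le hε
        (hW.abs_templateGraph_sub_le hn) hf s) _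
    intro x hx y hy
    rw [eval_filterPolynomial, eval_filterPolynomial]
    exact hL x hx y hy
  have h2 : ‖G.inducedGraphon.filter h (Xn.toL2 - X.toL2)‖ ≤ A' / n := by
    -- Comparison with the constant polynomial `1` shows that the filter is a contraction.
    have := norm_aeval_apply_le G.inducedGraphon.shift hG (Graphon.isSymmetric_shift _)
      (Graphon.norm_shift_le_one _) (p := filterPolynomial h) (q := 1)
      (fun x hx => by simpa [eval_filterPolynomial] using hone x hx) (Xn.toL2 - X.toL2)
    rw [← Graphon.filter_eq_aeval, map_one] at this
    exact this.trans (hX.norm_inducedSignal_sub_le hn)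
  have h3 : G.inducedFilterOutput h (X.sample n) - W.filter h X.toL2
      = (G.inducedGraphon.filter h X.toL2 - W.filter h X.toL2)
        + G.inducedGraphon.filter h (Xn.toL2 - X.toL2) := by
    rw [map_sub, WGraph.inducedFilterOutput]
    abel
  rw [h3]
  exact (norm_add_le _ _).trans (add_le_add h1 h2)

theorem proposition1 (W : Graphon) (X : GraphonSignal) {K : ℕ} (h : Fin K → ℝ)
    (A_w A_h a_h A_x c : ℝ) (hc0 : 0 < c) (hc1 : c ≤ 1)
    (hAS1 : W.IsLipschitz A_w)
    (hAS2 : FilterAssumption (spectralResponse h) A_h a_h c)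
    (hAS3 : X.IsLipschitz A_x)
    (n : ℕ) (hn : 1 ≤ n) :
    ‖(W.templateGraph n).inducedFilterOutput h (X.sample n) - W.filter h X.toL2‖ ≤
      (A_h + Real.pi * ((W.templateGraph n).inducedGraphon.bandCard c : ℝ) /
          eigenvalueMargin W (W.templateGraph n).inducedGraphon c) *
          (2 * A_w / n) * ‖X.toL2‖
        + A_x * (a_h * c + 2) / n + 2 * a_h * c * ‖X.toL2‖ := by
  have hLip := hAS2.isLipschitzOnReal (continuous_spectralResponse h) hc0
  refine (norm_inducedFilterOutput_sub_filter_le W X h hAS1 hAS3 hLip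
    (fun x hx => (hAS2.abs_lt_one x hx).le) hn).trans ?_
  have ha := hAS2.inner_nonneg hc0
  have hA_w := hAS1.const_nonneg
  have hA_x := hAS3.const_nonneg
  have hδ := eigenvalueMargin_nonneg W (W.templateGraph n).inducedGraphon c
  have hac : 0 ≤ a_h * c := mul_nonneg ha hc0.le
  have hX : 0 ≤ ‖X.toL2‖ := norm_nonneg _
  -- Only the sign matters. It also holds in the degenerate cases, where the margin is `0` (possibly
  -- as the infimum of the empty set) and division by zero gives `0`.
  have hgap : 0 ≤ Real.pi * ((W.templateGraph n).inducedGraphon.bandCard c : ℝ) /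
      eigenvalueMargin W (W.templateGraph n).inducedGraphon c := by positivity
  have h1 : A_h * (2 * A_w / n) * ‖X.toL2‖ ≤
      (A_h + Real.pi * ((W.templateGraph n).inducedGraphon.bandCard c : ℝ) /
        eigenvalueMargin W (W.templateGraph n).inducedGraphon c) * (2 * A_w / n) * ‖X.toL2‖ := by
    gcongr
    exact le_add_of_nonneg_right hgap
  have h2 : A_x / n ≤ A_x * (a_h * c + 2) / n := by
    gcongr
    exact le_mul_of_one_le_right hA_x (by linarith)
  have h3 : 0 ≤ 2 * a_h * c * ‖X.toL2‖ := by positivity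
  linarith
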